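/- For $B\in\mathbb N$, consider the synchronous $B$-Congested Clique: $n$ nodes with commonly known identifiers $1,\dots,n$, where in every round each node sends a $B$-bit message to every node. In the problem $\mathsf{AllToAllComm}$, each node $u$ is given $B$-bit messages $\{m_{u,v}\}_{v}$, and every node $v$ has to output all messages $\{m_{u,v}\}_{u}$. For $\alpha\ge 0$, an $\alpha$-ABD adversary is a computationally unbounded adaptive adversary that, in each round, chooses a set $F$ of edges of the complete graph such that every node is incident to at most $\alpha n$ edges of $F$, and replaces the messages sent over the edges of $F$ (in both directions) by arbitrary $B$-bit messages. Both choices may depend on the inputs and local states of all nodes, on all messages of previous rounds, and on the messages about to be sent in the current round; the nodes do not learn $F$. Theorem. Let $\alpha=O(1/\sqrt n)$ and $B=1$. Then a deterministic protocol solves $\mathsf{AllToAllComm}$ against every $\alpha$-ABD adversary in $O(1)$ rounds. Precisely: for every constant $C>0$ there is a number $R$ (depending only on $C$) such that for every $n$ and every $\alpha$ with $0\le\alpha\le C/\sqrt n$ and $\alpha\le 1/(8\cdot 10^4)$ there is a deterministic protocol on $n$ nodes with bandwidth $B=1$ and at most $R$ rounds such that, for all inputs and against every $\alpha$-ABD adversary,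 every node $v$ outputs $m_{u,v}$ for all $u$. (The condition $\alpha\le 1/(8\cdot 10^4)$ follows from $\alpha\le C/\sqrt n$ as soon as $n\ge(8\cdot 10^4\,C)^2$.) -/

import Mathlib

namespace CongestedClique

/-- A `B`-bit message. -/
abbrev Msg (B : ℕ) : Type := Fin B → Bool

/-- One `B`-bit message for every ordered pair of nodes: `M u v` goes from `u` to `v`.
It is used both for the messages of one communication round and for the input of the
all-to-all communication problem. -/
abbrev MsgTable (n B : ℕ) : Type := Fin n → Fin n → Msg B

/-- A deterministic protocol for the `B`-Congested Clique on `n` nodes with identifiers in `Fin n`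
(known to everybody), for a task where every node starts with one `B`-bit message per node and
outputs one `B`-bit message per node. What a node knows is its identifier, its input, and the
messages it received so far: `received` is the chronological list, one entry per past round, whose
entry `r` has the message `r u` that arrived from node `u`. Local computation is unrestricted, as
usual in this model. -/
structure Protocol (n B : ℕ) where
  /-- The number of communication rounds. -/
  rounds : ℕ
  /-- `send v input received w` is the message that `v` sends to `w` in the next round. -/
  send : (v : Fin n) → (input : Fin n → Msg B) → (received : List (Fin n → Msg B)) →
    Fin n → Msg B
  /-- `output v input received u` is the message that `v` finally outputs for the source `u`. -/
  output : (v : Fin n) → (input : Fin n → Msg B) → (received : List (Fin n → Msg B)) →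
    Fin n → Msg B

/-- Everything that happened in one round: the messages the nodes sent, the set of (undirected)
edges controlled by the adversary, and the messages that were delivered. -/
structure RoundRecord (n B : ℕ) where
  sent : MsgTable n B
  faulty : SimpleGraph (Fin n)
  delivered : MsgTable n B

/-- An adaptive (rushing) mobile edge adversary. In each round it sees the inputs of all nodes, the
complete history of the previous rounds (which, together with the inputs, determines the local
states of all nodes of a deterministic protocol), and the messages that the nodes are about to send
in the current round. From this it chooses the controlled edges of the round and the `B`-bit
messages to be delivered over these edges, in both directions. -/
structure Adversary (n B : ℕ) where
  edges : (input : MsgTable n B) → (history : List (RoundRecord n B)) →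
    (sent : MsgTable n B) → SimpleGraph (Fin n)
  content : (input : MsgTable n B) → (history : List (RoundRecord n B)) →
    (sent : MsgTable n B) → MsgTable n B

/-- The adversary is an `α`-ABD adversary (adaptive, `α`-Byzantine-degree): in each round, every
node is incident to at most `α * n` controlled edges. -/
def Adversary.IsABD {n B : ℕ} (A : Adversary n B) (α : ℝ) : Prop :=
  ∀ (input : MsgTable n B) (history : List (RoundRecord n B)) (sent : MsgTable n B) (v : Fin n),
    (((A.edges input history sent).neighborSet v).ncard : ℝ) ≤ α * n

/-- The messages received by `v` in the rounds of `history`. -/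
def view {n B : ℕ} (history : List (RoundRecord n B)) (v : Fin n) : List (Fin n → Msg B) :=
  history.map fun r u => r.delivered u v

open Classical in
/-- One round: the nodes prepare their messages, the adversary replaces those on the edges that it
controls, and all other messages are delivered unchanged. -/
noncomputable def nextRound {n B : ℕ} (P : Protocol n B) (A : Adversary n B)
    (input : MsgTable n B) (history : List (RoundRecord n B)) : RoundRecord n B :=
  let sent : MsgTable n B := fun u => P.send u (input u) (view history u)
  let F := A.edges input history sent
  { sent := sent
    faulty := F
    delivered := fun u v =>
      if F.Adj u v then A.content input history sent u v else sent u v }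

/-- The history of the first `t` rounds of `P` on `input` against `A`, in chronological order. -/
noncomputable def execution {n B : ℕ} (P : Protocol n B) (A : Adversary n B)
    (input : MsgTable n B) : ℕ → List (RoundRecord n B)
  | 0 => []
  | t + 1 => execution P A input t ++ [nextRound P A input (execution P A input t)]

/-- `P` solves the all-to-all communication problem against every `α`-ABD adversary: whatever the
input messages `m u v` (initially known to `u`) are, after the last round every node `v` outputs
`m u v` for every node `u`. -/
def Protocol.SolvesAllToAllComm {n B : ℕ} (P : Protocol n B) (α : ℝ) : Prop :=
  ∀ A : Adversary n B, A.IsABD α → ∀ (m : MsgTable n B) (v u : Fin n),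
    P.output v (m v) (view (execution P A m P.rounds) v) u = m u v

end CongestedClique

/-!
Write `k = ⌊α n⌋`; each round corrupts at most `k` entries in every row and every column of the
table of messages, and this is all that is used about the adversary.

Only finitely many `n` (depending on `C`) have to be excluded from the asymptotic argument. For
those the bits are sent one at a time: the source sends its bit to all nodes, all nodes forward it
to the target, and the target takes the nearest codeword of the repetition code. At most
`2 k < n / 2` of the copies are wrong (`Implements.allToAll_of_small`, `2 n²` rounds).

For large `n` a bit travels from `u` to `v` through two intermediate holders. Choose `p` with
`n ≤ p³ ≤ 8 n` and give every node a three-digit address in base `p`; an address that belongs to no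
node is simulated by a node, each node simulating at most eight addresses. In stage `j` the `j`-th
digit of the address of the holder is changed from that of `u` to that of `v`
(`Implements.relay_digit`). In one stage an address has to send `p²` bits to each of only `p`
addresses. These `p²` bits are encoded by a code of length `N ≈ n / (64 p)`, which is of order
`n^(2/3)`, over the alphabet of `B`-bit words; the `i`-th symbol is sent to the `i`-th node of a
block of `N` nodes, which forwards it to the target. The blocks are chosen as an edge colouring, so
that every node forwards at most one symbol to every node. At most `2 B k = O(√n)` symbols of
a codeword are changed, hence a code of constant rate and minimum distance `O(√n)`
suffices (`Implements.relay`). Such a code exists by the Gilbert-Varshamov argument, already with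
the crude bound `(N q + 1)^d` for the size of a Hamming ball of radius `d` (`exists_code`).
-/

namespace CongestedClique

/-! ### Robust protocols and their composition -/

/-- The tables of sent and of delivered messages differ in at most `k` entries of every row and of
every column: every node has at most `k` corrupted outgoing and `k` corrupted incoming messages. -/
def Close {n : ℕ} {A : Type} (k : ℕ) (s d : Fin n → Fin n → A) : Prop :=
  (∀ u, {v | s u v ≠ d u v}.ncard ≤ k) ∧ ∀ v, {u | s u v ≠ d u v}.ncard ≤ k

/-- What `v` received in the first `t` rounds, when `d i u v` is the bit delivered from `u` to `v`
in round `i`. -/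
def transcript {n : ℕ} (d : ℕ → Fin n → Fin n → Bool) (t : ℕ) (v : Fin n) :
    List (Fin n → Bool) :=
  (List.range t).map fun i u => d i u v

@[simp] theorem length_transcript {n : ℕ} (d : ℕ → Fin n → Fin n → Bool) (t : ℕ) (v : Fin n) :
    (transcript d t v).length = t := by
  simp [transcript]

theorem take_transcript {n : ℕ} (d : ℕ → Fin n → Fin n → Bool) (r t : ℕ) (v : Fin n) :
    (transcript d (r + t) v).take r = transcript d r v := by
  simp [transcript, List.range_add]

theorem drop_transcript {n : ℕ} (d : ℕ → Fin n → Fin n → Bool) (r t : ℕ) (v : Fin n) :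
    (transcript d (r + t) v).drop r = transcript (fun i => d (r + i)) t v := by
  simp [transcript, List.range_add, Function.comp_def]

/-- Some deterministic protocol with `r` rounds of one-bit messages, started with the local state
`x v : X` at every node `v`, ends with local states `y v : Y` such that `Rel x y`, whatever is
delivered, as long as in each round it is `k`-close to what was sent. A relation instead of
a function is needed since states between two stages may depend on the corruptions. -/
def Implements {n : ℕ} {X Y : Type} (k r : ℕ) (Rel : (Fin n → X) → (Fin n → Y) → Prop) : Prop :=
  ∃ (send : Fin n → X → List (Fin n → Bool) → Fin n → Bool)
    (out : Fin n → X → List (Fin n → Bool) → Y),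
    ∀ (x : Fin n → X) (d : ℕ → Fin n → Fin n → Bool),
      (∀ t < r, Close k (fun u => send u (x u) (transcript d t u)) (d t)) →
        Rel x fun v => out v (x v) (transcript d r v)

namespace Implements

variable {n k : ℕ} {X Y Z : Type}

theorem mono {r : ℕ} {Rel Rel' : (Fin n → X) → (Fin n → Y) → Prop} (h : Implements k r Rel)
    (hR : ∀ x y, Rel x y → Rel' x y) : Implements k r Rel' := by
  obtain ⟨s, o, h⟩ := h
  exact ⟨s, o, fun x d hd => hR _ _ (h x d hd)⟩

theorem comp {r₁ r₂ : ℕ} {Rel₁ : (Fin n → X) → (Fin n → Y) → Prop}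
    {Rel₂ : (Fin n → Y) → (Fin n → Z) → Prop} (h₁ : Implements k r₁ Rel₁)
    (h₂ : Implements k r₂ Rel₂) :
    Implements k (r₁ + r₂) (fun x z => ∃ y, Rel₁ x y ∧ Rel₂ y z) := by
  obtain ⟨s₁, o₁, h₁⟩ := h₁
  obtain ⟨s₂, o₂, h₂⟩ := h₂
  refine ⟨fun u x h => if h.length < r₁ then s₁ u x h
      else s₂ u (o₁ u x (h.take r₁)) (h.drop r₁),
    fun v x h => o₂ v (o₁ v x (h.take r₁)) (h.drop r₁), fun x d hd => ?_⟩
  refine ⟨fun v => o₁ v (x v) (transcript d r₁ v), h₁ x d fun t ht => ?_, ?_⟩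
  · simpa [ht] using hd t (by omega)
  · simp only [take_transcript, drop_transcript]
    refine h₂ _ (fun i => d (r₁ + i)) fun t ht => ?_
    simpa [take_transcript, drop_transcript] using hd (r₁ + t) (by omega)

/-- Local computation takes no rounds. -/
theorem localMap (f : Fin n → X → Y) : Implements k 0 (fun x y => y = fun v => f v (x v)) :=
  ⟨fun _ _ _ _ => false, fun v x _ => f v x, fun _ _ _ => rfl⟩

/-- Every node may keep its old state `M` while it runs a protocol on the part `g v` of it. -/
theorem withMemory {M : Type} {r : ℕ} {Rel : (Fin n → X) → (Fin n → Y) → Prop}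
    (h : Implements k r Rel) (g : Fin n → M → X) :
    Implements k r (fun (μ : Fin n → M) (z : Fin n → M × Y) =>
      (∀ v, (z v).1 = μ v) ∧ Rel (fun v => g v (μ v)) fun v => (z v).2) := by
  obtain ⟨s, o, h⟩ := h
  exact ⟨fun u μ => s u (g u μ), fun v μ l => (μ, o v (g v μ) l),
    fun μ d hd => ⟨fun _ => rfl, h _ d hd⟩⟩

theorem ncard_ne_le_mul {B : ℕ} (f g : Fin n → Fin B → Bool)
    (h : ∀ b, {v | f v b ≠ g v b}.ncard ≤ k) : {v | f v ≠ g v}.ncard ≤ B * k := by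
  have hsub : {v | f v ≠ g v} ⊆ ⋃ b : Fin B, {v | f v b ≠ g v b} := by
    intro v hv
    obtain ⟨b, hb⟩ := Function.ne_iff.1 hv
    exact Set.mem_iUnion.2 ⟨b, hb⟩
  calc {v | f v ≠ g v}.ncard ≤ (⋃ b : Fin B, {v | f v b ≠ g v b}).ncard :=
        Set.ncard_le_ncard hsub (Set.toFinite _)
    _ ≤ ∑ b : Fin B, {v | f v b ≠ g v b}.ncard := by
        simpa using Finset.set_ncard_biUnion_le Finset.univ fun b : Fin B => {v | f v b ≠ g v b}
    _ ≤ ∑ _b : Fin B, k := Finset.sum_le_sum fun b _ => h b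
    _ = B * k := by simp

/-- Messages of `B` bits are sent bit by bit in `B` rounds; the corrupted edges of these rounds add
up. -/
theorem exchange {B : ℕ} (msg : Fin n → X → Fin n → Fin B → Bool) :
    Implements k B (fun x (y : Fin n → Fin n → Fin B → Bool) =>
      Close (B * k) (fun u w => msg u (x u) w) fun u w => y w u) := by
  refine ⟨fun u x h w => if hb : h.length < B then msg u x w ⟨h.length, hb⟩ else false,
    fun v x h u b => h.getD b (fun _ => false) u, fun x d hd => ?_⟩
  have hget : ∀ (b : Fin B) (w u : Fin n),
      (transcript d B w).getD b (fun _ => false) u = d b u w := by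
    intro b w u
    simp [transcript, List.getD_eq_getElem?_getD]
  simp only [hget]
  have hd' : ∀ b : Fin B, Close k (fun u w => msg u (x u) w b) (d b) := fun b => by
    simpa using hd b b.2
  exact ⟨fun u => ncard_ne_le_mul _ _ fun b => (hd' b).1 u,
    fun v => ncard_ne_le_mul _ _ fun b => (hd' b).2 v⟩

/-- Coded relaying: every token `t : T` carries a bit, which is moved from `src t` to `dst t`.
Colours are blocks of `N` relay nodes. A node encodes the bits of all its tokens of colour `c`,
indexed by their labels, and sends the `i`-th symbol to the `i`-th relay of block `c`. Since `hdst`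
lets a relay of block `c` read off from `c` and `v` which node's symbol `v` needs, it can forward
that symbol in a single exchange. Both exchanges together change at most `2 * (B * k)` symbols of
any codeword that reaches its target. -/
theorem relay {T K Λ : Type} {N B : ℕ} (src dst : T → Fin n) (col : T → K) (lab : T → Λ)
    (e : K × Fin N ↪ Fin n) (enc : (Λ → Bool) → Fin N → Fin B → Bool)
    (henc : ∀ a b, a ≠ b → 4 * (B * k) < hammingDist (enc a) (enc b))
    (hlab : ∀ t t', src t = src t' → col t = col t' → lab t = lab t' → t = t')
    (hdst : ∀ t t', dst t = dst t' → col t = col t' → src t = src t') :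
    Implements k (B + B) (fun x y : Fin n → T → Bool => ∀ t, y (dst t) t = x (src t) t) := by
  classical
  -- The bits that `u` sends through block `c`, indexed by labels; missing labels get `false`.
  let payload (u : Fin n) (x : T → Bool) (c : K) (l : Λ) : Bool :=
    decide (∃ t, src t = u ∧ col t = c ∧ lab t = l ∧ x t = true)
  -- The block and the position in it of a node; nodes outside all blocks stay silent.
  let slot (w : Fin n) : Option (K × Fin N) := if h : ∃ q, e q = w then some h.choose else none
  have hslot : ∀ q, slot (e q) = some q := by
    intro q
    have h : ∃ q', e q' = e q := ⟨q, rfl⟩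
    simp only [slot, dif_pos h]
    rw [e.injective h.choose_spec]
  -- The node from which `v` gets tokens of colour `c`; a dummy value if there are none.
  let source (v : Fin n) (c : K) : Fin n :=
    if h : ∃ t, dst t = v ∧ col t = c then src h.choose else v
  have hsource : ∀ t, source (dst t) (col t) = src t := by
    intro t
    have h : ∃ t', dst t' = dst t ∧ col t' = col t := ⟨t, rfl, rfl⟩
    simp only [source, dif_pos h]
    exact hdst _ _ h.choose_spec.1 h.choose_spec.2
  -- Decoding within half the minimum distance.
  let dec (w : Fin N → Fin B → Bool) : Λ → Bool :=
    if h : ∃ a, hammingDist (enc a) w ≤ 2 * (B * k) then h.choose else fun _ => false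
  have hdec : ∀ a w, hammingDist (enc a) w ≤ 2 * (B * k) → dec w = a := by
    intro a w haw
    have h : ∃ a, hammingDist (enc a) w ≤ 2 * (B * k) := ⟨a, haw⟩
    simp only [dec, dif_pos h]
    by_contra hne
    have h1 := henc _ _ hne
    have h2 := hammingDist_triangle (enc h.choose) w (enc a)
    have h3 := h.choose_spec
    rw [hammingDist_comm w] at h2
    omega
  have E₁ := exchange (n := n) (k := k) (B := B) (X := T → Bool) fun u x w =>
    match slot w with
    | some q => enc (payload u x q.1) q.2
    | none => fun _ => false
  have E₂ := exchange (n := n) (k := k) (B := B) (X := Fin n → Fin B → Bool) fun w r v =>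
    match slot w with
    | some q => r (source v q.1)
    | none => fun _ => false
  have L := localMap (n := n) (k := k) (X := Fin n → Fin B → Bool) (Y := T → Bool)
    fun _ r t => dec (fun i => r (e (col t, i))) (lab t)
  refine ((E₁.comp E₂).comp L).mono ?_
  rintro x z ⟨r₂, ⟨r₁, h₁, h₂⟩, rfl⟩ t
  have key : hammingDist (enc (payload (src t) (x (src t)) (col t)))
      (fun i => r₂ (dst t) (e (col t, i))) ≤ 2 * (B * k) := by
    have hrow := h₁.1 (src t)
    have hcol := h₂.2 (dst t)
    rw [hammingDist, ← Set.ncard_coe_finset]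
    let g : Fin N → Fin n := fun i => e (col t, i)
    have hg : Function.Injective g := fun i j hij => by simpa [g] using hij
    rw [← Set.ncard_image_of_injective _ hg, two_mul]
    refine le_trans (Set.ncard_le_ncard ?_ (Set.toFinite _))
      ((Set.ncard_union_le _ _).trans (add_le_add hrow hcol))
    rintro _ ⟨i, hi, rfl⟩
    -- A symbol that was corrupted in neither exchange arrives unchanged.
    by_contra hcon
    simp only [Set.mem_union, Set.mem_ofPred_eq, not_or, not_not, g, hslot, hsource] at hcon
    simp only [Finset.coe_filter, Finset.mem_univ, true_and, Set.mem_ofPred_eq] at hi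
    exact hi (hcon.1.trans hcon.2)
  simp only [hdec _ _ key, payload]
  rw [Bool.eq_iff_iff, decide_eq_true_iff]
  constructor
  · rintro ⟨t', h1, h2, h3, h4⟩
    rwa [hlab _ _ h1 h2 h3] at h4
  · exact fun h => ⟨t, rfl, rfl, rfl, h⟩

end Implements

/-! ### Codes with large distance -/

theorem card_hammingBall_le {N : ℕ} {A : Type} [Fintype A] [DecidableEq A] (x : Fin N → A)
    (d : ℕ) :
    (Finset.univ.filter fun y => hammingDist x y ≤ d).card ≤ (N * Fintype.card A + 1) ^ d := by
  induction d with
  | zero => simp [Finset.filter_eq]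
  | succ d ih =>
    have hsub : (Finset.univ.filter fun y => hammingDist x y ≤ d + 1) ⊆
        (Finset.univ.filter fun y => hammingDist x y ≤ d) ∪
          ((Finset.univ.filter fun y => hammingDist x y ≤ d) ×ˢ
            (Finset.univ : Finset (Fin N × A))).image
              fun q => Function.update q.1 q.2.1 q.2.2 := by
      intro y hy
      simp only [Finset.mem_filter, Finset.mem_univ, true_and] at hy
      by_cases hle : hammingDist x y ≤ d
      · simp [hle]
      -- A word at distance `d + 1` is a one-letter change of the word obtained by correcting one
      -- letter, which is at distance `d`.
      · have hne : x ≠ y := by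
          rintro rfl
          simp at hle
        obtain ⟨i, hi⟩ := Function.ne_iff.1 hne
        refine Finset.mem_union_right _ (Finset.mem_image.2
          ⟨(Function.update y i (x i), (i, y i)), ?_, by simp⟩)
        simp only [Finset.mem_product, Finset.mem_filter, Finset.mem_univ, true_and, and_true]
        refine Nat.le_of_lt_succ (lt_of_lt_of_le (Finset.card_lt_card ?_) hy)
        refine Finset.ssubset_iff_of_subset ?_ |>.2 ⟨i, by simp [hi], by simp⟩
        intro j hj
        rcases eq_or_ne j i with rfl | hji
        · simp at hj
        · simpa [Function.update_of_ne hji] using hj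
    calc _ ≤ _ := Finset.card_le_card hsub
      _ ≤ _ := Finset.card_union_le _ _
      _ ≤ (N * Fintype.card A + 1) ^ d + (N * Fintype.card A + 1) ^ d * (N * Fintype.card A) := by
        refine add_le_add ih (Finset.card_image_le.trans ?_)
        rw [Finset.card_product]
        exact Nat.mul_le_mul ih (by simp)
      _ = _ := by ring

/-- The Gilbert-Varshamov bound: codewords are chosen greedily outside the Hamming balls of radius
`d` around the earlier ones. -/
theorem exists_code {N : ℕ} {A M : Type} [Fintype A] [DecidableEq A] [Fintype M] [DecidableEq M]
    (d : ℕ) (h : Fintype.card M * (N * Fintype.card A + 1) ^ d ≤ Fintype.card A ^ N) :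
    ∃ enc : M → Fin N → A, ∀ a b, a ≠ b → d < hammingDist (enc a) (enc b) := by
  suffices H : ∀ S : Finset M, ∃ enc : M → Fin N → A,
      ∀ a ∈ S, ∀ b ∈ S, a ≠ b → d < hammingDist (enc a) (enc b) by
    obtain ⟨enc, henc⟩ := H Finset.univ
    exact ⟨enc, fun a b => henc a (Finset.mem_univ _) b (Finset.mem_univ _)⟩
  intro S
  induction S using Finset.induction_on with
  | empty =>
    rcases isEmpty_or_nonempty M with hM | hM
    · exact ⟨fun a => hM.elim a, by simp⟩
    · have hpos : 0 < Fintype.card (Fin N → A) := by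
        simpa using lt_of_lt_of_le (by positivity) h
      obtain ⟨w⟩ := Fintype.card_pos_iff.1 hpos
      exact ⟨fun _ => w, by simp⟩
  | insert m S hm ih =>
    obtain ⟨enc, henc⟩ := ih
    have hcard : (S.biUnion fun a =>
        Finset.univ.filter fun y => hammingDist (enc a) y ≤ d).card < Fintype.card (Fin N → A) := by
      have hS : S.card < Fintype.card M := Finset.card_lt_univ_of_notMem hm
      calc _ ≤ S.card * (N * Fintype.card A + 1) ^ d :=
            Finset.card_biUnion_le_card_mul _ _ _ fun a _ => card_hammingBall_le _ _
        _ < Fintype.card M * (N * Fintype.card A + 1) ^ d :=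
            Nat.mul_lt_mul_of_pos_right hS (by positivity)
        _ ≤ Fintype.card (Fin N → A) := by simpa using h
    obtain ⟨w, hw⟩ : ∃ w, w ∉ S.biUnion fun a =>
        Finset.univ.filter fun y => hammingDist (enc a) y ≤ d := by
      by_contra! hall
      rw [Finset.eq_univ_iff_forall.2 hall, Finset.card_univ] at hcard
      exact lt_irrefl _ hcard
    have hw' : ∀ a ∈ S, d < hammingDist (enc a) w := by simpa using hw
    refine ⟨Function.update enc m w, fun a ha b hb hab => ?_⟩
    rcases Finset.mem_insert.1 ha with rfl | haS <;> rcases Finset.mem_insert.1 hb with rfl | hbS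
    · exact absurd rfl hab
    · rw [Function.update_self, Function.update_of_ne hab.symm, hammingDist_comm]
      exact hw' b hbS
    · rw [Function.update_self, Function.update_of_ne hab]
      exact hw' a haS
    · rw [Function.update_of_ne (ne_of_mem_of_not_mem haS hm),
        Function.update_of_ne (ne_of_mem_of_not_mem hbS hm)]
      exact henc a haS b hbS hab

/-! ### Few nodes: one bit at a time -/

/-- The all-to-all communication problem as a relation between initial and final states, for
inputs `x u v` (the bit that `u` has for `v`). -/
def AllToAll (n : ℕ) (x y : Fin n → Fin n → Bool) : Prop := ∀ u v, y v u = x u v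

/-- With fewer than `n / 4` corruptions per node, a single bit can be sent by repetition. -/
theorem Implements.allToAll_of_small {n k : ℕ} (hk : n ≠ 0 → 4 * k < n) :
    Implements k (2 * n ^ 2) (AllToAll n) := by
  classical
  -- Nodes keep their input and a table of the bits that arrived so far.
  have step : ∀ S : Finset (Fin n × Fin n), Implements k (2 * S.card)
      (fun (x : Fin n → Fin n → Bool) (z : Fin n → (Fin n → Bool) × (Fin n × Fin n → Bool)) =>
        (∀ v, (z v).1 = x v) ∧ ∀ t ∈ S, (z t.2).2 t = x t.1 t.2) := by
    intro S
    induction S using Finset.induction_on with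
    | empty =>
      refine (Implements.localMap fun _ x => (x, fun _ => false)).mono ?_
      rintro x z rfl
      simp
    | insert t S ht ih =>
      have hn : n ≠ 0 := by
        have := t.1.2
        omega
      have hrelay := Implements.relay (n := n) (k := k) (T := Unit) (K := Unit) (Λ := Unit)
        (N := n) (B := 1) (fun _ => t.1) (fun _ => t.2) id id
        ⟨Prod.snd, fun a b h => Prod.ext rfl h⟩ (fun a _ _ => a ()) (by
          intro a b hab
          have hab' : a () ≠ b () := fun h => hab (funext fun _ => h)
          have : hammingDist (fun (_ : Fin n) (_ : Fin 1) => a ())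
              (fun (_ : Fin n) (_ : Fin 1) => b ()) = n := by
            have hne : (fun (_ : Fin 1) => a ()) ≠ fun _ => b () := fun h => hab' (congrFun h 0)
            simp [hammingDist, hne]
          rw [this, one_mul]
          exact hk hn) (fun _ _ _ _ _ => rfl) (fun _ _ _ _ => rfl)
      have L := Implements.localMap (n := n) (k := k)
        fun _ (z : ((Fin n → Bool) × (Fin n × Fin n → Bool)) × (Unit → Bool)) =>
          (z.1.1, Function.update z.1.2 t (z.2 ()))
      have := (ih.comp (hrelay.withMemory
        fun _ (z : (Fin n → Bool) × (Fin n × Fin n → Bool)) _ => z.1 t.2)).comp L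
      rw [Finset.card_insert_of_notMem ht]
      refine this.mono ?_
      rintro x _ ⟨q, ⟨y, ⟨hy₁, hy₂⟩, hq₁, hq₂⟩, rfl⟩
      refine ⟨fun v => by simp [hq₁, hy₁], fun s hs => ?_⟩
      rcases eq_or_ne s t with rfl | hst
      · simpa [hy₁] using hq₂ ()
      · simpa [hst, hq₁] using hy₂ s (Finset.mem_of_mem_insert_of_ne hs hst)
  have L := Implements.localMap (n := n) (k := k)
    fun v (z : (Fin n → Bool) × (Fin n × Fin n → Bool)) u => z.2 (u, v)
  have := ((step Finset.univ).comp L).mono (Rel' := AllToAll n) (by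
    rintro x _ ⟨z, ⟨-, hz⟩, rfl⟩ u v
    exact hz (u, v) (Finset.mem_univ _))
  simpa [sq] using this

/-! ### Many nodes: routing digit by digit -/

/-- The address that holds the bit for the pair `t = (u, v)` after `j` stages: the first `j` digits
are those of `v`, the other digits are those of `u`. -/
def holder {n p : ℕ} (addr : Fin n → Fin 3 → Fin p) (j : ℕ) (t : Fin n × Fin n) : Fin 3 → Fin p :=
  fun i => if (i : ℕ) < j then addr t.2 i else addr t.1 i

/-- Stage `j` of the routing. The address `x` is simulated by the node `host x`, as its `copy x`-th
address. The colour of a token that moves from address `x` to `y` is `x j + y j` together with the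
copy numbers of `x` and `y`. Given `x` or `y`, whose digits other than the `j`-th are the same, the
colour determines the other address, so the colouring is proper. The label consists of the digits
of the pair that can be seen neither in `x` nor in `y`. -/
theorem Implements.relay_digit {n p k N B : ℕ} [NeZero p] (addr : Fin n ↪ (Fin 3 → Fin p))
    (host : (Fin 3 → Fin p) → Fin n) (copy : (Fin 3 → Fin p) → Fin 8)
    (hinj : ∀ x y, host x = host y → copy x = copy y → x = y)
    (hN : 64 * p * N ≤ n)
    (hcode : 2 ^ p ^ 2 * (N * 2 ^ B + 1) ^ (4 * (B * k)) ≤ (2 ^ B) ^ N) (j : Fin 3) :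
    Implements k (B + B) (fun x y : Fin n → Fin n × Fin n → Bool =>
      ∀ t, y (host (holder addr (j + 1) t)) t = x (host (holder addr j t)) t) := by
  classical
  have hcardΛ : Fintype.card ({i : Fin 3 // i ≠ j} → Fin p) = p ^ 2 := by
    simp [Fintype.card_subtype_compl]
  obtain ⟨enc, henc⟩ := exists_code (N := N) (A := Fin B → Bool)
    (M := ({i : Fin 3 // i ≠ j} → Fin p) → Bool) (4 * (B * k)) (by
      simpa only [Fintype.card_fun, hcardΛ, Fintype.card_bool, Fintype.card_fin] using hcode)
  obtain ⟨e⟩ := Function.Embedding.nonempty_of_card_le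
    (α := (Fin p × Fin 8 × Fin 8) × Fin N) (β := Fin n) (by
      simp only [Fintype.card_prod, Fintype.card_fin]
      linarith)
  have hother : ∀ t (i : Fin 3), i ≠ j → holder addr (j + 1) t i = holder addr j t i := by
    intro t i hi
    have : (i : ℕ) ≠ j := fun h => hi (Fin.ext h)
    simp only [holder]
    congr 1
    exact propext ⟨fun h => by omega, fun h => by omega⟩
  refine Implements.relay _ _
    (fun t => (holder addr j t j + holder addr (j + 1) t j,
      copy (holder addr j t), copy (holder addr (j + 1) t)))
    (fun t (i : {i : Fin 3 // i ≠ j}) => if (i : Fin 3) < j then addr t.1 i else addr t.2 i)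
    e enc henc ?_ ?_
  · intro t t' hs hc hl
    simp only [Prod.mk.injEq] at hc
    have hx := hinj _ _ hs hc.2.1
    have hyj : holder addr (j + 1) t j = holder addr (j + 1) t' j := by
      have := hc.1
      rw [hx] at this
      exact add_left_cancel this
    have hlab : ∀ i, i ≠ j → (if i < j then addr t.1 i else addr t.2 i) =
        if i < j then addr t'.1 i else addr t'.2 i := fun i hi => congrFun hl ⟨i, hi⟩
    have hxi : ∀ i, holder addr j t i = holder addr j t' i := fun i => congrFun hx i
    simp only [holder] at hyj hxi
    refine Prod.ext (addr.injective (funext fun i => ?_)) (addr.injective (funext fun i => ?_))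
    all_goals
      rcases lt_trichotomy i j with h | h | h
      · have h1 := hlab i h.ne
        have h2 := hxi i
        have h' : (i : ℕ) < j := h
        simp_all
      · subst h
        have h2 := hxi i
        simp_all
      · have h1 := hlab i h.ne'
        have h2 := hxi i
        have h' : ¬ (i : ℕ) < j := not_lt.2 h.le
        have h'' : ¬ i < j := not_lt.2 h.le
        simp_all
  · intro t t' hd hc
    simp only [Prod.mk.injEq] at hc
    have hy := hinj _ _ hd hc.2.2
    have hxj : holder addr j t j = holder addr j t' j := by
      have := hc.1
      rw [hy] at this
      exact add_right_cancel this
    congr 1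
    funext i
    rcases eq_or_ne i j with rfl | hi
    · exact hxj
    · rw [← hother t i hi, ← hother t' i hi, hy]

/-- Three stages solve the problem whenever the parameters `p`, `N`, `B` allow the code. Address
number `a < p ^ 3` is simulated by the node `a % n`, as its address number `a / n < 8`. -/
theorem Implements.allToAll_of_code {n p k N B : ℕ} [NeZero p] (hn : 0 < n) (hp : n ≤ p ^ 3)
    (hp' : p ^ 3 ≤ 8 * n) (hN : 64 * p * N ≤ n)
    (hcode : 2 ^ p ^ 2 * (N * 2 ^ B + 1) ^ (4 * (B * k)) ≤ (2 ^ B) ^ N) :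
    Implements k (6 * B) (AllToAll n) := by
  let idx : (Fin 3 → Fin p) ≃ Fin (p ^ 3) := finFunctionFinEquiv
  let addr : Fin n ↪ (Fin 3 → Fin p) := (Fin.castLEEmb hp).trans idx.symm.toEmbedding
  let host : (Fin 3 → Fin p) → Fin n := fun x => ⟨idx x % n, Nat.mod_lt _ hn⟩
  let copy : (Fin 3 → Fin p) → Fin 8 := fun x =>
    ⟨idx x / n, Nat.div_lt_of_lt_mul (by have := (idx x).2; linarith)⟩
  have hinj : ∀ x y, host x = host y → copy x = copy y → x = y := by
    intro x y h₁ h₂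
    simp only [host, copy, Fin.mk.injEq] at h₁ h₂
    apply idx.injective
    apply Fin.ext
    rw [← Nat.div_add_mod (idx x : ℕ) n, h₁, h₂, Nat.div_add_mod]
  have haddr : ∀ u, host (addr u) = u := by
    intro u
    apply Fin.ext
    simp [host, addr, Nat.mod_eq_of_lt u.2]
  have R := Implements.relay_digit (k := k) addr host copy hinj hN hcode
  have L₀ := Implements.localMap (n := n) (k := k)
    fun _ (x : Fin n → Bool) (t : Fin n × Fin n) => x t.2
  have L₁ := Implements.localMap (n := n) (k := k)
    fun v (x : Fin n × Fin n → Bool) (u : Fin n) => x (u, v)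
  have := ((((L₀.comp (R 0)).comp (R 1)).comp (R 2)).comp L₁).mono (Rel' := AllToAll n) (by
    rintro x _ ⟨y₃, ⟨y₂, ⟨y₁, ⟨_, rfl, h₁⟩, h₂⟩, h₃⟩, rfl⟩ u v
    have hstart : holder addr ((0 : Fin 3) : ℕ) (u, v) = addr u := by
      funext i
      simp [holder]
    have hend : holder addr ((2 : Fin 3) + 1 : ℕ) (u, v) = addr v := by
      funext i
      have := i.2
      simp [holder, this]
    have e₁ := h₁ (u, v)
    have e₂ := h₂ (u, v)
    have e₃ := h₃ (u, v)
    rw [hstart, haddr] at e₁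
    rw [hend, haddr] at e₃
    exact e₃.trans (e₂.trans e₁))
  convert this using 1
  ring

/-! ### Choice of parameters -/

theorem exists_const_mul_sq_le_two_pow (c : ℕ) : ∃ L₀ : ℕ, ∀ L ≥ L₀, c * L ^ 2 ≤ 2 ^ L := by
  have h := tendsto_pow_const_div_const_pow_of_one_lt 2 (one_lt_two (α := ℝ))
  have hpos : (0 : ℝ) < 1 / (c + 1) := by positivity
  obtain ⟨L₀, hL₀⟩ := Filter.eventually_atTop.1 (h.eventually (gt_mem_nhds hpos))
  refine ⟨L₀, fun L hL => ?_⟩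
  have h1 := hL₀ L hL
  rw [div_lt_div_iff₀ (by positivity) (by positivity)] at h1
  have h2 : ((c * L ^ 2 : ℕ) : ℝ) ≤ ((2 ^ L : ℕ) : ℝ) := by
    push_cast
    nlinarith [sq_nonneg (L : ℝ)]
  exact_mod_cast h2

theorem exists_polylog_le (A B : ℕ) :
    ∃ p₀ : ℕ, ∀ p ≥ p₀, A * (B + 3 * (Nat.log 2 p + 1)) ^ 2 ≤ p := by
  obtain ⟨L₀, hL₀⟩ := exists_const_mul_sq_le_two_pow (A * (B + 6) ^ 2)
  refine ⟨2 ^ (L₀ + 1), fun p hp => ?_⟩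
  have hp0 : p ≠ 0 := by
    rintro rfl
    simp at hp
  have hL : L₀ + 1 ≤ Nat.log 2 p := Nat.le_log_of_pow_le one_lt_two hp
  calc A * (B + 3 * (Nat.log 2 p + 1)) ^ 2
      ≤ A * ((B + 6) * Nat.log 2 p) ^ 2 := by
        gcongr
        nlinarith
    _ = A * (B + 6) ^ 2 * Nat.log 2 p ^ 2 := by ring
    _ ≤ 2 ^ Nat.log 2 p := hL₀ _ (by omega)
    _ ≤ p := Nat.pow_log_le_self 2 hp0

theorem exists_cube_approx {n : ℕ} (hn : 0 < n) : ∃ p, n ≤ p ^ 3 ∧ p ^ 3 ≤ 8 * n := by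
  have hex : ∃ p, n ≤ p ^ 3 := ⟨n, Nat.le_self_pow (by norm_num) n⟩
  refine ⟨Nat.find hex, Nat.find_spec hex, ?_⟩
  rcases h : Nat.find hex with _ | q
  · simp
  · have hq : q ^ 3 < n := not_le.1 (Nat.find_min hex (by omega))
    rcases Nat.eq_zero_or_pos q with rfl | hq0
    · omega
    · calc (q + 1) ^ 3 ≤ (2 * q) ^ 3 := Nat.pow_le_pow_left (by omega) 3
        _ = 8 * q ^ 3 := by ring
        _ ≤ 8 * n := by omega

/-- If `k = O(√n)`, then `B = 2048` works for large `n`: with `N = n / (64 p)` one has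
`2 p² ≤ B N`, so half of the `B N` bits of a codeword pay for the `p²` bits of information, and the
other half pays for the size `2^(O(√n log n))` of a Hamming ball. -/
theorem Implements.allToAll_of_large (K : ℕ) :
    ∃ n₀ : ℕ, ∀ n ≥ n₀, ∀ k, k ^ 2 ≤ K ^ 2 * n → Implements k (6 * 2048) (AllToAll n) := by
  obtain ⟨p₀, hp₀⟩ := exists_polylog_le (16 * 2048 ^ 2 * K ^ 2) 2048
  refine ⟨(p₀ + 32) ^ 3, fun n hn k hk => ?_⟩
  have hn0 : 0 < n := lt_of_lt_of_le (by positivity) hn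
  obtain ⟨p, hp, hp'⟩ := exists_cube_approx hn0
  have hpp : p₀ + 32 ≤ p := (Nat.pow_le_pow_iff_left (by norm_num : 3 ≠ 0)).1 (hn.trans hp)
  have : NeZero p := ⟨by omega⟩
  have hp0 : 0 < p := by omega
  set N := n / (64 * p)
  have hN : 64 * p * N ≤ n := Nat.mul_div_le n (64 * p)
  have hN' : n < 64 * p * (N + 1) := Nat.lt_mul_div_succ n (by omega)
  have hpN : p ^ 2 < 512 * (N + 1) := by
    have : p * p ^ 2 < p * (512 * (N + 1)) := by
      calc p * p ^ 2 = p ^ 3 := by ring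
        _ ≤ 8 * n := hp'
        _ < 8 * (64 * p * (N + 1)) := by omega
        _ = p * (512 * (N + 1)) := by ring
    exact Nat.lt_of_mul_lt_mul_left this
  have hp2 : 32 ^ 2 ≤ p ^ 2 := Nat.pow_le_pow_left (by omega) 2
  have hNn : N + 1 ≤ p ^ 3 := by
    have : N ≤ 64 * p * N := Nat.le_mul_of_pos_left _ (by omega)
    have : 64 * N ≤ 64 * p * N := Nat.mul_le_mul_right _ (by omega)
    omega
  set L := Nat.log 2 p + 1
  have hL : p ≤ 2 ^ L := (Nat.lt_pow_succ_log_self one_lt_two p).le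
  have hbase (B : ℕ) : N * 2 ^ B + 1 ≤ 2 ^ (B + 3 * L) := by
    have h1 : 1 ≤ 2 ^ B := Nat.one_le_two_pow
    calc N * 2 ^ B + 1 ≤ 2 ^ B * (N + 1) := by
          rw [mul_add, mul_one, mul_comm]
          exact Nat.add_le_add_left h1 _
      _ ≤ 2 ^ B * (2 ^ L) ^ 3 :=
          Nat.mul_le_mul_left _ (hNn.trans (Nat.pow_le_pow_left hL 3))
      _ = 2 ^ (B + 3 * L) := by rw [← pow_mul, ← pow_add, mul_comm L]
  -- After squaring, this is the polylogarithmic bound times `k² ≤ K² p³`.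
  have hexp : (2048 + 3 * L) * (4 * (2048 * k)) ≤ p ^ 2 := by
    rw [← Nat.pow_le_pow_iff_left two_ne_zero]
    calc ((2048 + 3 * L) * (4 * (2048 * k))) ^ 2
        = 16 * 2048 ^ 2 * (2048 + 3 * L) ^ 2 * k ^ 2 := by ring
      _ ≤ 16 * 2048 ^ 2 * (2048 + 3 * L) ^ 2 * (K ^ 2 * p ^ 3) :=
          Nat.mul_le_mul_left _ (hk.trans (Nat.mul_le_mul_left _ hp))
      _ = 16 * 2048 ^ 2 * K ^ 2 * (2048 + 3 * L) ^ 2 * p ^ 3 := by ring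
      _ ≤ p * p ^ 3 := Nat.mul_le_mul_right _ (hp₀ p (by omega))
      _ = (p ^ 2) ^ 2 := by ring
  refine Implements.allToAll_of_code (N := N) hn0 hp hp' hN ?_
  calc 2 ^ p ^ 2 * (N * 2 ^ 2048 + 1) ^ (4 * (2048 * k))
      ≤ 2 ^ p ^ 2 * (2 ^ (2048 + 3 * L)) ^ (4 * (2048 * k)) :=
        Nat.mul_le_mul_left _ (Nat.pow_le_pow_left (hbase _) _)
    _ ≤ 2 ^ p ^ 2 * 2 ^ p ^ 2 := by
        rw [← pow_mul]
        exact Nat.mul_le_mul_left _ (Nat.pow_le_pow_right two_pos hexp)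
    _ = 2 ^ (p ^ 2 + p ^ 2) := (pow_add _ _ _).symm
    _ ≤ 2 ^ (2048 * N) := Nat.pow_le_pow_right two_pos (by omega)
    _ = (2 ^ 2048) ^ N := pow_mul _ _ _

/-! ### From robust protocols to the model -/

theorem Implements.exists_protocol {n r : ℕ} {α : ℝ}
    (h : Implements ⌊α * n⌋₊ r (AllToAll n)) :
    ∃ P : Protocol n 1, P.rounds = r ∧ P.SolvesAllToAllComm α := by
  obtain ⟨s, o, h⟩ := h
  let P : Protocol n 1 :=
    { rounds := r
      send := fun v x l w _ => s v (fun w => x w 0) (l.map fun a u => a u 0) w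
      output := fun v x l u _ => o v (fun w => x w 0) (l.map fun a u => a u 0) u }
  refine ⟨P, rfl, fun A hA m v u => ?_⟩
  let d : ℕ → Fin n → Fin n → Bool := fun t u v =>
    (nextRound P A m (execution P A m t)).delivered u v 0
  have hview : ∀ t v,
      (view (execution P A m t) v).map (fun a u => a u 0) = transcript d t v := by
    intro t v
    induction t with
    | zero => simp [execution, view, transcript]
    | succ t ih =>
      rw [execution, view, List.map_append, List.map_append]
      change (view (execution P A m t) v).map (fun a u => a u 0) ++ _ = _
      rw [ih]
      simp [transcript, List.range_succ, d]
  -- Only messages over controlled edges are changed; this relation is symmetric.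
  have hfaulty : ∀ t u w,
      s u (fun w => m u w 0) (transcript d t u) w ≠ d t u w →
        (A.edges m (execution P A m t)
          fun u => P.send u (m u) (view (execution P A m t) u)).Adj u w := by
    intro t u w hne
    by_contra hadj
    have hd : d t u w = P.send u (m u) (view (execution P A m t) u) w 0 := by
      simp only [d, nextRound, if_neg hadj]
    exact hne (by rw [hd, ← hview])
  have hdeg : ∀ t u, ((A.edges m (execution P A m t)
      fun u => P.send u (m u) (view (execution P A m t) u)).neighborSet u).ncard ≤
        ⌊α * n⌋₊ := fun t u => Nat.le_floor (hA _ _ _ u)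
  have hmain := h (fun u w => m u w 0) d (fun t _ =>
    ⟨fun u => (Set.ncard_le_ncard (fun w hw => hfaulty t u w hw) (Set.toFinite _)).trans (hdeg t u),
      fun w => (Set.ncard_le_ncard (fun u hu => (hfaulty t u w hu).symm)
        (Set.toFinite _)).trans (hdeg t w)⟩) u v
  funext i
  rw [Subsingleton.elim i 0]
  simp only [P, hview]
  exact hmain

end CongestedClique

theorem mainTheorem5 :
    ∀ C : ℝ, 0 < C → ∃ R : ℕ, ∀ (n : ℕ) (α : ℝ),
      0 ≤ α → α ≤ 1 / (8 * 10 ^ 4) → α ≤ C / Real.sqrt n →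
        ∃ P : CongestedClique.Protocol n 1, P.rounds ≤ R ∧ P.SolvesAllToAllComm α := by
  intro C hC
  obtain ⟨n₀, hn₀⟩ := CongestedClique.Implements.allToAll_of_large ⌈C⌉₊
  refine ⟨max (2 * n₀ ^ 2) (6 * 2048), fun n α hα hα₁ hα₂ => ?_⟩
  have hfloor : ((⌊α * n⌋₊ : ℕ) : ℝ) ≤ α * n := Nat.floor_le (by positivity)
  rcases le_total n₀ n with hn | hn
  · obtain ⟨P, hP, hsol⟩ := (hn₀ n hn ⌊α * n⌋₊ (by
      have h1 : α * n ≤ C * Real.sqrt n := by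
        calc α * n ≤ C / Real.sqrt n * n := by gcongr
          _ = C * Real.sqrt n := by rw [div_mul_eq_mul_div, mul_div_assoc, Real.div_sqrt]
      have h2 : ((⌊α * n⌋₊ : ℕ) : ℝ) ≤ ⌈C⌉₊ * Real.sqrt n :=
        hfloor.trans (h1.trans (by gcongr; exact Nat.le_ceil C))
      have h3 : ((⌊α * n⌋₊ : ℕ) : ℝ) ^ 2 ≤ (⌈C⌉₊ : ℝ) ^ 2 * n := by
        calc _ ≤ ((⌈C⌉₊ : ℝ) * Real.sqrt n) ^ 2 := by gcongr
          _ = _ := by rw [mul_pow, Real.sq_sqrt (Nat.cast_nonneg n)]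
      exact_mod_cast h3)).exists_protocol
    exact ⟨P, hP.le.trans (le_max_right _ _), hsol⟩
  · obtain ⟨P, hP, hsol⟩ := (CongestedClique.Implements.allToAll_of_small (n := n)
      (k := ⌊α * n⌋₊) (by
        intro h0
        have hpos : (0 : ℝ) < n := by positivity
        have h1 : α * n ≤ 1 / (8 * 10 ^ 4) * n := by gcongr
        have h2 : ((4 * ⌊α * n⌋₊ : ℕ) : ℝ) < n := by
          push_cast
          linarith
        exact_mod_cast h2)).exists_protocol
    refine ⟨P, hP.le.trans (le_max_of_le_left ?_), hsol⟩
    gcongr
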